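/- Let $d \ge 1$, let $\theta_0\in\mathbb{R}^d$, and let $\widehat\theta_1,\dots,\widehat\theta_B$ be independent $\mathbb{R}^d$-valued random vectors (not necessarily identically distributed), regarded as estimators of $\theta_0$. 1. If $\mathbb{P}\bigl(c^\top(\widehat\theta_j-\theta_0)\le 0\bigr)=1/2$ for every $1\le j\le B$ and every $c\in\mathbb{R}^d\setminus\{0\}$, and $B\ge d+1$, then $$\mathbb{P}\bigl(\theta_0\in \mathrm{ConvHull}(\{\widehat\theta_j:1\le j\le B\})\bigr)=\frac{1}{2^{B-1}}\sum_{i=0}^{B-d-1}\binom{B-1}{i},$$ where $\mathrm{ConvHull}$ denotes the convex hull. 2. For a real random variable $Y$ and $t\in\mathbb{R}$ put $$\mathrm{Med\text{-}Bias}_t(Y)=\Bigl(\tfrac12-\min\{\mathbb{P}(Y-t\ge0),\,\mathbb{P}(Y-t\le0)\}\Bigr)_+,\qquad (x)_+=\max\{x,0\},$$ let $e_1,\dots,e_d$ be the canonical basis of $\mathbb{R}^d$, and, for $B \ge 1$, let $$\Delta=\max_{1\le k\le d}\ \max_{1\le j\le B}\ \mathrm{Med\text{-}Bias}_{e_k^\top\theta_0}(e_k^\top\widehat\theta_j).$$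 Let $\mathrm{RectHull}(\{\widehat\theta_j : 1\le j\le B\})=\prod_{k=1}^d\bigl[\min_{1\le j\le B}e_k^\top\widehat\theta_j,\ \max_{1\le j\le B}e_k^\top\widehat\theta_j\bigr]$. Then, for every $B\ge1$, $$\mathbb{P}\bigl(\theta_0\notin \mathrm{RectHull}(\{\widehat\theta_j:1\le j\le B\})\bigr)\le d\left\{\Bigl(\tfrac12+\Delta\Bigr)^B+\Bigl(\tfrac12-\Delta\Bigr)^B\right\}.$$ -/

import Mathlib

open MeasureTheory ProbabilityTheory

noncomputable section

/-- Median bias of a real estimator `Y` for `t`: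
`(1/2 - min {P(Y - t ≥ 0), P(Y - t ≤ 0)})₊`. -/
def medBias {Ω : Type*} [MeasurableSpace Ω] (P : Measure Ω) (Y : Ω → ℝ) (t : ℝ) : ℝ :=
  max (1 / 2 - min (P.real {ω | 0 ≤ Y ω - t}) (P.real {ω | Y ω - t ≤ 0})) 0

/-- Coordinate-wise maximum median bias of the estimators `θ j` for `θ₀`. The index sets are
finite, so that the suprema are maxima as soon as `1 ≤ d` and `1 ≤ B`. -/
def maxMedBias {Ω : Type*} [MeasurableSpace Ω] (P : Measure Ω) {d B : ℕ}
    (θ : Fin B → Ω → EuclideanSpace ℝ (Fin d)) (θ₀ : EuclideanSpace ℝ (Fin d)) : ℝ :=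
  ⨆ k : Fin d, ⨆ j : Fin B, medBias P (fun ω => θ j ω k) (θ₀ k)

/-- The rectangular hull of the points `x j`: the product over the coordinates `k` of the
intervals `[min_j x_j(k), max_j x_j(k)]` (for `1 ≤ B`). -/
def rectHull {d B : ℕ} (x : Fin B → EuclideanSpace ℝ (Fin d)) :
    Set (EuclideanSpace ℝ (Fin d)) :=
  {y | ∀ k : Fin d, y k ∈ Set.Icc (⨅ j : Fin B, x j k) (⨆ j : Fin B, x j k)}

end

/-! Hull: `θ₀` is missed exactly when all `X j = θ j - θ₀` lie in one open half-space
(`notMem_convexHull_range_iff`). For independent symmetric vectors charging no hyperplane through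
the origin, Wendel's argument applies: flipping signs does not change this probability, while the
number of sign patterns that succeed is almost surely the number of regions of a central arrangement
in general position (`regionCount_eq`). Averaging over the signs gives the formula.

The `X j` need not be symmetric, but the event depends only on their directions, and the direction
laws are symmetric (`map_neg_eq_of_halfspace_sphere`). Averaging the half-space condition over a
Gaussian normal vector centred at `a` gives `∫ Φ(-⟪a, u⟫) = 1/2`, with `Φ` the normal distribution
function. Differentiating along `τ • a` and approximating by polynomials in `exp (-y ^ 2)` gives `∫
sin ⟪u, a⟫ = 0` for all `a`, so the characteristic function is real.

Rectangle: if `θ₀` is missed, some coordinate lies strictly on one side of all estimates. A union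
bound, independence and `prod_add_prod_le_pow_add_pow` finish. -/

/-- If `a j, b j ≤ u` and `a j + b j ≤ u + v`, then the sum of the two products is at most
`u ^ n + v ^ n`. -/
lemma prod_add_prod_le_pow_add_pow {ι : Type*} (s : Finset ι) {a b : ι → ℝ} {u v : ℝ}
    (hv : 0 ≤ v) (hvu : v ≤ u) (ha : ∀ j, 0 ≤ a j) (hb : ∀ j, 0 ≤ b j)
    (hau : ∀ j, a j ≤ u) (hbu : ∀ j, b j ≤ u) (hab : ∀ j, a j + b j ≤ u + v) :
    ∏ j ∈ s, a j + ∏ j ∈ s, b j ≤ u ^ s.card + v ^ s.card := by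
  classical
  -- `α * A + β * B = α * (A - B) + (α + β) * B ≤ u * A + v * B = (u - v) * A + v * (A + B)`, and
  -- the last expression is at most `u * U + v * V`.
  have step : ∀ A B α β U V : ℝ, 0 ≤ A → 0 ≤ B → B ≤ A → A ≤ U → A + B ≤ U + V →
      α ≤ u → α + β ≤ u + v → α * A + β * B ≤ u * U + v * V := by
    intro A B α β U V hA hB hBA hAU hABU hα hαβ
    nlinarith [mul_le_mul_of_nonneg_left hαβ hB,
      mul_le_mul_of_nonneg_left hα (sub_nonneg.2 hBA),
      mul_le_mul_of_nonneg_left hABU hv, mul_le_mul_of_nonneg_left hAU (sub_nonneg.2 hvu)]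
  induction s using Finset.induction_on with
  | empty => simp
  | insert i s hi ih =>
    rw [Finset.prod_insert hi, Finset.prod_insert hi, Finset.card_insert_of_notMem hi,
      pow_succ', pow_succ']
    have hA : ∏ j ∈ s, a j ≤ u ^ s.card := by
      simpa using Finset.prod_le_prod (s := s) (fun j _ => ha j) fun j _ => hau j
    have hB : ∏ j ∈ s, b j ≤ u ^ s.card := by
      simpa using Finset.prod_le_prod (s := s) (fun j _ => hb j) fun j _ => hbu j
    have hA0 : 0 ≤ ∏ j ∈ s, a j := Finset.prod_nonneg fun j _ => ha j
    have hB0 : 0 ≤ ∏ j ∈ s, b j := Finset.prod_nonneg fun j _ => hb j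
    rcases le_total (∏ j ∈ s, b j) (∏ j ∈ s, a j) with h | h
    · exact step _ _ _ _ _ _ hA0 hB0 h hA ih (hau i) (hab i)
    · have := step _ _ _ _ _ _ hB0 hA0 h hB (by linarith) (hbu i)
        (by linarith [hab i] : b i + a i ≤ u + v)
      linarith

/-! ### Separation of a point from a convex hull -/

section Hull

variable {E : Type*} [NormedAddCommGroup E] [InnerProductSpace ℝ E]

/-- A point lies outside the convex hull of a finite family iff it is strictly separated from it. -/
lemma notMem_convexHull_range_iff [FiniteDimensional ℝ E] {ι : Type*} [Finite ι] (y : ι → E) (t : E) :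
    t ∉ convexHull ℝ (Set.range y) ↔ ∃ c : E, ∀ j, 0 < inner ℝ c (y j - t) := by
  constructor
  · intro h
    have hc : IsClosed (convexHull ℝ (Set.range y)) :=
      ((Set.finite_range y).isCompact_convexHull (𝕜 := ℝ)).isClosed
    obtain ⟨f, u, hu, hf⟩ := geometric_hahn_banach_point_closed (convex_convexHull ℝ _) hc h
    refine ⟨(InnerProductSpace.toDual ℝ E).symm f, fun j => ?_⟩
    rw [InnerProductSpace.toDual_symm_apply, map_sub]
    linarith [hf _ (subset_convexHull ℝ _ (Set.mem_range_self j))]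
  · rintro ⟨c, hc⟩ h
    have hconv : Convex ℝ {z : E | inner ℝ c t < inner ℝ c z} :=
      convex_halfSpace_gt (f := fun z => inner ℝ c z)
        ⟨fun a b => inner_add_right _ _ _, fun r a => inner_smul_right _ _ _⟩ _
    have hsub : convexHull ℝ (Set.range y) ⊆ {z : E | inner ℝ c t < inner ℝ c z} := by
      refine convexHull_min ?_ hconv
      rintro _ ⟨j, rfl⟩
      have := hc j
      rw [inner_sub_right] at this
      simpa using this
    have := hsub h
    simp at this

/-- Families admitting a vector with positive inner product with all members form an open set. -/
lemma isOpen_exists_forall_inner_pos {ι : Type*} [Finite ι] :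
    IsOpen {y : ι → E | ∃ c : E, ∀ j, 0 < inner ℝ c (y j)} := by
  have : {y : ι → E | ∃ c : E, ∀ j, 0 < inner ℝ c (y j)} =
      ⋃ c : E, ⋂ j, {y : ι → E | 0 < inner ℝ c (y j)} := by
    ext; simp
  rw [this]
  refine isOpen_iUnion fun c => isOpen_iInter_of_finite fun j => ?_
  exact isOpen_lt continuous_const (by fun_prop)

end Hull

/-! ### Counting regions of central hyperplane arrangements -/

section Count

variable {E : Type*} [NormedAddCommGroup E] [InnerProductSpace ℝ E]

/-- The vectors `x j` are in general position with respect to the subspace `W`: any `k ≤ dim W`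
of the hyperplanes `(x j)ᗮ` cut out a subspace of codimension `k` in `W`. -/
def GenPos {n : ℕ} (W : Submodule ℝ E) (x : Fin n → E) : Prop :=
  ∀ S : Finset (Fin n), S.card ≤ Module.finrank ℝ W →
    Module.finrank ℝ (W ⊓ (Submodule.span ℝ (x '' S))ᗮ : Submodule ℝ E) + S.card =
      Module.finrank ℝ W

/-- The number of sign vectors `ε` for which some `c ∈ W` satisfies `0 < ⟪c, ε j • x j⟫` for
all `j`. -/
noncomputable def regionCount {n : ℕ} (W : Submodule ℝ E) (x : Fin n → E) : ℕ :=
  open Classical in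
  ∑ ε : Fin n → ℤˣ, if ∃ c ∈ W, ∀ j, 0 < inner ℝ c (ε j • x j) then 1 else 0

lemma exists_pos_forall_inner_add_smul_pos {ι : Type*} [Finite ι] (y : ι → E) (c w : E)
    (h : ∀ j, 0 < inner ℝ c (y j)) :
    ∃ δ > 0, ∀ t : ℝ, |t| < δ → ∀ j, 0 < inner ℝ (c + t • w) (y j) := by
  have : ∀ᶠ t : ℝ in nhds 0, ∀ j, 0 < inner ℝ (c + t • w) (y j) := by
    rw [Filter.eventually_all]
    intro j
    have hcont : Continuous fun t : ℝ => inner ℝ (c + t • w) (y j) := by fun_prop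
    exact hcont.continuousAt.eventually (lt_mem_nhds (by simpa using h j))
  obtain ⟨δ, hδ, h⟩ := Metric.eventually_nhds_iff.1 this
  exact ⟨δ, hδ, fun t ht => h (by simpa using ht)⟩

lemma GenPos.tail {n : ℕ} {W : Submodule ℝ E} {x : Fin (n + 1) → E} (h : GenPos W x) :
    GenPos W (Fin.tail x) := by
  intro S hS
  have := h (S.map (Fin.succEmb n)) (by simpa using hS)
  rw [Finset.card_map, Finset.coe_map, Set.image_image] at this
  exact this

lemma GenPos.finrank_inf_orthogonal {n : ℕ} {W : Submodule ℝ E} {x : Fin (n + 1) → E}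
    (h : GenPos W x) (hW : 1 ≤ Module.finrank ℝ W) :
    Module.finrank ℝ (W ⊓ (Submodule.span ℝ {x 0})ᗮ : Submodule ℝ E) + 1 =
      Module.finrank ℝ W := by
  have := h {0} (by rwa [Finset.card_singleton])
  rwa [Finset.card_singleton, Finset.coe_singleton, Set.image_singleton] at this

/-- Adjoining index `0` to `S` raises the codimension in `W` by one, which is exactly the dimension
lost by passing to the section. -/
lemma GenPos.restrict {n : ℕ} {W : Submodule ℝ E} {x : Fin (n + 1) → E} (h : GenPos W x)
    (hW : 1 ≤ Module.finrank ℝ W) :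
    GenPos (W ⊓ (Submodule.span ℝ {x 0})ᗮ) (Fin.tail x) := by
  intro S hS
  have h1 := h.finrank_inf_orthogonal hW
  have h0 : (0 : Fin (n + 1)) ∉ S.map (Fin.succEmb n) := by
    simp [Fin.succ_ne_zero]
  have hc : (insert 0 (S.map (Fin.succEmb n))).card = S.card + 1 := by
    rw [Finset.card_insert_of_notMem h0, Finset.card_map]
  have := h (insert 0 (S.map (Fin.succEmb n))) (by omega)
  have hspan : (Submodule.span ℝ (x '' (insert 0 (S.map (Fin.succEmb n)) : Finset _)))ᗮ =
      (Submodule.span ℝ {x 0})ᗮ ⊓ (Submodule.span ℝ (Fin.tail x '' S))ᗮ := by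
    rw [Submodule.inf_orthogonal, ← Submodule.span_union]
    congr 2
    rw [Finset.coe_insert, Finset.coe_map, Set.image_insert_eq, Set.image_image]
    rfl
  rw [hspan, hc, ← inf_assoc] at this
  omega

/-- The deletion-restriction recursion. -/
lemma regionCount_succ {n : ℕ} {W : Submodule ℝ E} {x : Fin (n + 1) → E} (h : GenPos W x)
    (hW : 1 ≤ Module.finrank ℝ W) :
    regionCount W x = regionCount W (Fin.tail x) +
      regionCount (W ⊓ (Submodule.span ℝ {x 0})ᗮ) (Fin.tail x) := by
  classical
  have h1 := h.finrank_inf_orthogonal hW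
  obtain ⟨w, hwW, hw⟩ : ∃ w ∈ W, 0 < inner ℝ w (x 0) := by
    by_contra! hcon
    have : W ⊓ (Submodule.span ℝ {x 0})ᗮ = W := by
      refine inf_eq_left.2 fun w hw => ?_
      rw [Submodule.mem_orthogonal_singleton_iff_inner_left]
      refine le_antisymm (hcon w hw) ?_
      simpa using hcon (-w) (W.neg_mem hw)
    rw [this] at h1
    omega
  unfold regionCount
  -- Fix the signs of the tail. The cone they define is nonempty (`r`), reaches the positive (`p`)
  -- or negative (`q`) side of the hyperplane of `x 0`, or meets that hyperplane (`s`). It is cut in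
  -- two exactly when `s` holds.
  rw [← (Fin.consEquiv fun _ : Fin (n + 1) => ℤˣ).sum_comp, Fintype.sum_prod_type_right,
    ← Finset.sum_add_distrib]
  refine Finset.sum_congr rfl fun ε _ => ?_
  have huniv : (Finset.univ : Finset ℤˣ) = {1, -1} := by decide
  rw [huniv, Finset.sum_pair (by decide)]
  simp only [Fin.consEquiv_apply, Fin.forall_fin_succ, Fin.cons_zero, Fin.cons_succ, one_smul,
    Units.neg_smul, inner_neg_right, Fin.tail, Submodule.mem_inf,
    Submodule.mem_orthogonal_singleton_iff_inner_left, Left.neg_pos_iff]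
  set p : Prop := ∃ c ∈ W, 0 < inner ℝ c (x 0) ∧ ∀ j : Fin n, 0 < inner ℝ c (ε j • x j.succ)
  set q := ∃ c ∈ W, inner ℝ c (x 0) < 0 ∧ ∀ j : Fin n, 0 < inner ℝ c (ε j • x j.succ)
  set r := ∃ c ∈ W, ∀ j : Fin n, 0 < inner ℝ c (ε j • x j.succ)
  set s := ∃ c, (c ∈ W ∧ inner ℝ c (x 0) = 0) ∧ ∀ j : Fin n, 0 < inner ℝ c (ε j • x j.succ)
  have hpr : p → r := fun ⟨c, hc, _, h⟩ => ⟨c, hc, h⟩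
  have hqr : q → r := fun ⟨c, hc, _, h⟩ => ⟨c, hc, h⟩
  have hsr : s → r := fun ⟨c, hc, h⟩ => ⟨c, hc.1, h⟩
  have hsp : s → p ∧ q := by
    rintro ⟨c, ⟨hc, hc0⟩, hcj⟩
    obtain ⟨δ, hδ, h⟩ := exists_pos_forall_inner_add_smul_pos _ c w hcj
    refine ⟨⟨c + (δ / 2) • w, W.add_mem hc (W.smul_mem _ hwW), ?_, h _ ?_⟩,
      ⟨c + (-(δ / 2)) • w, W.add_mem hc (W.smul_mem _ hwW), ?_, h _ ?_⟩⟩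
    · rw [inner_add_left, hc0, real_inner_smul_left]; positivity
    · rw [abs_of_pos (by positivity)]; linarith
    · rw [inner_add_left, hc0, real_inner_smul_left]
      have := mul_pos (half_pos hδ) hw
      linarith
    · rw [abs_neg, abs_of_pos (by positivity)]; linarith
  have hrpq : r → p ∨ q := by
    rintro ⟨c, hc, hcj⟩
    rcases lt_trichotomy (inner ℝ c (x 0)) 0 with h | h | h
    · exact Or.inr ⟨c, hc, h, hcj⟩
    · exact Or.inl (hsp ⟨c, ⟨hc, h⟩, hcj⟩).1
    · exact Or.inl ⟨c, hc, h, hcj⟩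
  -- A positive combination of points on the two sides, weighted to land on the hyperplane, stays in
  -- the convex cone.
  have hpqs : p → q → s := by
    rintro ⟨c, hc, hc0, hcj⟩ ⟨e, he, he0, hej⟩
    refine ⟨inner ℝ c (x 0) • e + (-inner ℝ e (x 0)) • c,
      ⟨W.add_mem (W.smul_mem _ he) (W.smul_mem _ hc), ?_⟩, fun j => ?_⟩
    · rw [inner_add_left, real_inner_smul_left, real_inner_smul_left]; ring
    · rw [inner_add_left, real_inner_smul_left, real_inner_smul_left]
      have := mul_pos hc0 (hej j)
      have := mul_pos (neg_pos.2 he0) (hcj j)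
      linarith
  have key : ∀ (p q r s : Prop) [Decidable p] [Decidable q] [Decidable r] [Decidable s],
      (p → r) → (q → r) → (s → r) → (s → p ∧ q) → (r → p ∨ q) → (p → q → s) →
      (if p then 1 else 0) + (if q then 1 else 0) =
        (if r then 1 else 0) + (if s then 1 else 0) := by
    intro p q r s _ _ _ _ _ _ _ _ _ _
    by_cases p <;> by_cases q <;> by_cases r <;> by_cases s <;> simp_all
  exact key p q r s hpr hqr hsr hsp hrpq hpqs

/-- The number of regions of `n + 1` hyperplanes through the origin in general position. -/
theorem regionCount_eq [FiniteDimensional ℝ E] {n : ℕ} {W : Submodule ℝ E} {x : Fin (n + 1) → E} (h : GenPos W x) :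
    regionCount W x = 2 * ∑ i ∈ Finset.range (Module.finrank ℝ W), n.choose i := by
  induction n generalizing W with
  | zero =>
    rcases Nat.eq_zero_or_pos (Module.finrank ℝ W) with h0 | hpos
    -- Only `c = 0` is available and there is at least one strict inequality, so both sides vanish.
    · have hW : W = ⊥ := Submodule.finrank_eq_zero.1 h0
      subst hW
      simp [regionCount]
    · rw [regionCount_succ h hpos]
      obtain ⟨k, hk⟩ := Nat.exists_eq_add_of_le' hpos
      rw [hk, Finset.sum_range_succ']
      have h1 : ∀ (W : Submodule ℝ E) (y : Fin 0 → E), regionCount W y = 1 := fun W y => by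
        have : ∃ c, c ∈ W := ⟨0, W.zero_mem⟩
        simp [regionCount, this]
      simp [h1]
  | succ n ih =>
    rcases Nat.eq_zero_or_pos (Module.finrank ℝ W) with h0 | hpos
    · have hW : W = ⊥ := Submodule.finrank_eq_zero.1 h0
      subst hW
      simp [regionCount]
    · rw [regionCount_succ h hpos, ih h.tail, ih (h.restrict hpos)]
      have h1 := h.finrank_inf_orthogonal hpos
      rw [← h1, Finset.sum_range_succ' (fun i => (n + 1).choose i),
        Finset.sum_range_succ' (fun i => n.choose i)]
      simp only [Nat.choose_succ_succ, Finset.sum_add_distrib, Nat.choose_zero_right]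
      ring

lemma GenPos.of_linearIndepOn [FiniteDimensional ℝ E] {n : ℕ} {x : Fin n → E}
    (h : ∀ S : Finset (Fin n), S.card ≤ Module.finrank ℝ E → LinearIndepOn ℝ x (S : Set (Fin n))) :
    GenPos (⊤ : Submodule ℝ E) x := by
  intro S hS
  rw [finrank_top] at hS ⊢
  have h1 := finrank_span_eq_card (h S hS)
  have h2 := Submodule.finrank_add_finrank_orthogonal (𝕜 := ℝ) (Submodule.span ℝ (x '' S))
  have h3 : Module.finrank ℝ (Submodule.span ℝ (x '' S)) = S.card := by
    rw [Set.image_eq_range]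
    simpa using h1
  rw [top_inf_eq]
  omega

end Count

/-! ### Gaussian averages and odd integrals on the line -/

section OddPart

lemma hasDerivAt_gaussianReal_Iic (x : ℝ) :
    HasDerivAt (fun x => (gaussianReal 0 1).real (Set.Iic x)) (gaussianPDFReal 0 1 x) x := by
  have hcont : Continuous (gaussianPDFReal 0 1) := by
    unfold gaussianPDFReal; fun_prop
  have hint := integrable_gaussianPDFReal 0 1
  have heq : (fun x => (gaussianReal 0 1).real (Set.Iic x)) = fun x =>
      (∫ t in Set.Iic (0 : ℝ), gaussianPDFReal 0 1 t) + ∫ t in (0 : ℝ)..x, gaussianPDFReal 0 1 t := by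
    funext x
    rw [← intervalIntegral.integral_Iic_sub_Iic hint.integrableOn hint.integrableOn,
      measureReal_def, gaussianReal_apply_eq_integral 0 one_ne_zero,
      ENNReal.toReal_ofReal (integral_nonneg fun t => gaussianPDFReal_nonneg 0 1 t)]
    ring
  rw [heq]
  exact (intervalIntegral.integral_hasDerivAt_right (hcont.intervalIntegrable _ _)
    (hcont.stronglyMeasurableAtFilter _ _) hcont.continuousAt).const_add _

variable {ρ : Measure ℝ} [IsProbabilityMeasure ρ] {M : ℝ}

/-- Differentiating a constant Gaussian average of a bounded law. -/
lemma integral_mul_gaussianPDFReal_eq_zero (hM : ∀ᵐ y ∂ρ, |y| ≤ M)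
    (h : ∀ τ : ℝ, ∫ y, (gaussianReal 0 1).real (Set.Iic (-(τ * y))) ∂ρ = 1 / 2) (τ : ℝ) :
    ∫ y, y * gaussianPDFReal 0 1 (τ * y) ∂ρ = 0 := by
  set Φ : ℝ → ℝ := fun x => (gaussianReal 0 1).real (Set.Iic x) with hΦ
  have hΦc : Continuous Φ :=
    continuous_iff_continuousAt.2 fun x => (hasDerivAt_gaussianReal_Iic x).continuousAt
  have hcont : Continuous (gaussianPDFReal 0 1) := by
    unfold gaussianPDFReal; fun_prop
  have hpdf : ∀ x, |gaussianPDFReal 0 1 x| ≤ 1 := by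
    intro x
    rw [abs_of_nonneg (gaussianPDFReal_nonneg 0 1 x)]
    unfold gaussianPDFReal
    have h1 : (√(2 * Real.pi * (1 : NNReal)))⁻¹ ≤ 1 := by
      refine inv_le_one_of_one_le₀ (Real.one_le_sqrt.2 ?_)
      have := Real.pi_gt_three
      simp only [NNReal.coe_one, mul_one]
      linarith
    have h2 : Real.exp (-(x - 0) ^ 2 / (2 * (1 : NNReal))) ≤ 1 := by
      refine Real.exp_le_one_iff.2 ?_
      have := sq_nonneg (x - 0)
      simp only [NNReal.coe_one, mul_one]
      linarith
    exact mul_le_one₀ h1 (Real.exp_pos _).le h2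
  have hM0 : 0 ≤ M := by
    obtain ⟨y, hy⟩ := hM.exists
    exact (abs_nonneg y).trans hy
  have key := hasDerivAt_integral_of_dominated_loc_of_deriv_le (μ := ρ) (s := Set.univ)
    (F := fun τ y => Φ (-(τ * y))) (F' := fun τ y => gaussianPDFReal 0 1 (-(τ * y)) * -y)
    (x₀ := τ) (bound := fun _ => M) Filter.univ_mem
    (Filter.Eventually.of_forall fun τ => by
      exact (hΦc.comp (by fun_prop : Continuous fun y : ℝ => -(τ * y))).aestronglyMeasurable)
    (Integrable.of_bound (C := 1)
      (hΦc.comp (by fun_prop : Continuous fun y : ℝ => -(τ * y))).aestronglyMeasurable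
      (Filter.Eventually.of_forall fun y => by
        rw [Real.norm_of_nonneg measureReal_nonneg]
        exact measureReal_le_one))
    (by
      have : Continuous fun y : ℝ => gaussianPDFReal 0 1 (-(τ * y)) * -y := by fun_prop
      exact this.aestronglyMeasurable)
    (by
      filter_upwards [hM] with y hy τ' _
      rw [Real.norm_eq_abs, abs_mul, abs_neg]
      calc _ ≤ 1 * M := mul_le_mul (hpdf _) hy (abs_nonneg _) zero_le_one
        _ = M := one_mul M)
    (integrable_const M)
    (Filter.Eventually.of_forall fun y τ' _ => by
      have h1 : HasDerivAt (fun τ : ℝ => -(τ * y)) (-y) τ' := (hasDerivAt_mul_const y).fun_neg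
      exact (hasDerivAt_gaussianReal_Iic (-(τ' * y))).comp τ' h1)
  have hd := key.2
  have hconst : (fun τ : ℝ => ∫ y, Φ (-(τ * y)) ∂ρ) = fun _ => 1 / 2 := funext h
  rw [hconst] at hd
  have h0 := hd.unique (hasDerivAt_const τ (1 / 2 : ℝ))
  have heven : ∀ x, gaussianPDFReal 0 1 (-x) = gaussianPDFReal 0 1 x := fun x => by
    simp [gaussianPDFReal]
  simp only [heven, mul_neg, integral_neg, neg_eq_zero] at h0
  simpa only [mul_comm] using h0

/-- If `∫ y exp (-n y ^ 2) = 0` for all `n ≥ 1`, then the odd function `sin` integrates to zero. -/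
lemma integral_sin_eq_zero_of_forall_exp (hM : ∀ᵐ y ∂ρ, |y| ≤ M)
    (h : ∀ n : ℕ, 1 ≤ n → ∫ y, y * Real.exp (-y ^ 2) ^ n ∂ρ = 0) :
    ∫ y, Real.sin y ∂ρ = 0 := by
  have hM0 : 0 ≤ M := by
    obtain ⟨y, hy⟩ := hM.exists
    exact (abs_nonneg y).trans hy
  have hint : ∀ n : ℕ, Integrable (fun y => y * Real.exp (-y ^ 2) ^ n) ρ := fun n => by
    refine Integrable.of_bound (C := M)
      (by fun_prop : Continuous fun y : ℝ => y * Real.exp (-y ^ 2) ^ n).aestronglyMeasurable ?_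
    filter_upwards [hM] with y hy
    rw [Real.norm_eq_abs, abs_mul, abs_of_pos (pow_pos (Real.exp_pos _) n)]
    have : Real.exp (-y ^ 2) ^ n ≤ 1 :=
      pow_le_one₀ (Real.exp_pos _).le (Real.exp_le_one_iff.2 (by have := sq_nonneg y; linarith))
    calc _ ≤ M * 1 := mul_le_mul hy this (pow_pos (Real.exp_pos _) n).le hM0
      _ = M := mul_one M
  -- The extra factor `exp (-y ^ 2)` keeps every exponent at least `1`, as `h` requires.
  have hpoly : ∀ p : Polynomial ℝ,
      Integrable (fun y => y * (Real.exp (-y ^ 2) * p.eval (Real.exp (-y ^ 2)))) ρ ∧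
      ∫ y, y * (Real.exp (-y ^ 2) * p.eval (Real.exp (-y ^ 2))) ∂ρ = 0 := by
    intro p
    have heq : (fun y : ℝ => y * (Real.exp (-y ^ 2) * p.eval (Real.exp (-y ^ 2)))) = fun y =>
        ∑ i ∈ Finset.range (p.natDegree + 1),
          p.coeff i * (y * Real.exp (-y ^ 2) ^ (i + 1)) := by
      funext y
      rw [Polynomial.eval_eq_sum_range, Finset.mul_sum, Finset.mul_sum]
      exact Finset.sum_congr rfl fun i _ => by ring
    rw [heq]
    refine ⟨integrable_finsetSum _ fun i _ => (hint _).const_mul _, ?_⟩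
    rw [integral_finsetSum _ fun i _ => (hint _).const_mul _]
    refine Finset.sum_eq_zero fun i _ => ?_
    rw [integral_const_mul, h _ (Nat.le_add_left 1 i), mul_zero]
  have hsin : Integrable Real.sin ρ :=
    Integrable.of_bound (C := 1) Real.continuous_sin.aestronglyMeasurable
      (Filter.Eventually.of_forall fun y => Real.abs_sin_le_one y)
  -- At `z = exp (-y ^ 2)` the square root is `|y|`, so `y * (z * g z) = y * sinc y = sin y`; `g` is
  -- continuous away from `z = 0`.
  set g : ℝ → ℝ := fun z => Real.sinc (√(-Real.log z)) / z with hg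
  have hpos : ∀ z ∈ Set.Icc (Real.exp (-M ^ 2)) 1, z ≠ 0 := fun z hz =>
    ((Real.exp_pos _).trans_le hz.1).ne'
  have hgc : ContinuousOn g (Set.Icc (Real.exp (-M ^ 2)) 1) := by
    refine ContinuousOn.div ?_ continuousOn_id hpos
    refine Real.continuous_sinc.comp_continuousOn ?_
    refine Real.continuous_sqrt.comp_continuousOn ?_
    exact (Real.continuousOn_log.mono fun z hz => hpos z hz).neg
  have hgsin : ∀ y : ℝ, y * (Real.exp (-y ^ 2) * g (Real.exp (-y ^ 2))) = Real.sin y := by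
    intro y
    have h1 : Real.exp (-y ^ 2) * g (Real.exp (-y ^ 2)) = Real.sinc |y| := by
      simp only [hg, Real.log_exp, neg_neg, Real.sqrt_sq_eq_abs]
      field_simp
    have h2 : Real.sinc |y| = Real.sinc y := by
      rcases abs_choice y with h | h <;> rw [h]
      exact Real.sinc_neg y
    rw [h1, h2, Real.sinc_apply]
    split_ifs with h0
    · simp [h0]
    · field_simp
  refine abs_eq_zero.1 (le_antisymm (le_of_forall_pos_le_add fun ε hε => ?_) (abs_nonneg _))
  obtain ⟨p, hp⟩ := exists_polynomial_near_of_continuousOn _ _ g hgc (ε / (M + 1)) (by positivity)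
  have hsub : ∫ y, Real.sin y ∂ρ =
      ∫ y, (Real.sin y - y * (Real.exp (-y ^ 2) * p.eval (Real.exp (-y ^ 2)))) ∂ρ := by
    rw [integral_sub hsin (hpoly p).1, (hpoly p).2, sub_zero]
  rw [hsub, zero_add]
  have hb := norm_integral_le_of_norm_le_const (μ := ρ) (C := ε)
    (f := fun y => Real.sin y - y * (Real.exp (-y ^ 2) * p.eval (Real.exp (-y ^ 2)))) ?_
  · simpa using hb
  filter_upwards [hM] with y hy
  have hy2 : y ^ 2 ≤ M ^ 2 := by
    rw [← sq_abs y]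
    exact pow_le_pow_left₀ (abs_nonneg y) hy 2
  have hz1 : Real.exp (-y ^ 2) ≤ 1 :=
    Real.exp_le_one_iff.2 (by have := sq_nonneg y; linarith)
  have hz := hp (Real.exp (-y ^ 2)) ⟨Real.exp_le_exp.2 (by linarith), hz1⟩
  rw [← hgsin y, ← mul_sub, ← mul_sub, Real.norm_eq_abs, abs_mul, abs_mul, abs_sub_comm,
    abs_of_pos (Real.exp_pos _)]
  calc |y| * (Real.exp (-y ^ 2) * |p.eval (Real.exp (-y ^ 2)) - g (Real.exp (-y ^ 2))|)
      ≤ M * (1 * (ε / (M + 1))) := by gcongr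
    _ = ε * (M / (M + 1)) := by ring
    _ ≤ ε * 1 := by
      gcongr
      exact (div_le_one (by linarith)).2 (by linarith)
    _ = ε := mul_one ε

/-- The choice `τ = √(2 * n)` turns the Gaussian density at `τ * y` into a constant multiple of `exp
(-y ^ 2) ^ n`. -/
lemma integral_sin_eq_zero_of_gaussianReal (hM : ∀ᵐ y ∂ρ, |y| ≤ M)
    (h : ∀ τ : ℝ, ∫ y, (gaussianReal 0 1).real (Set.Iic (-(τ * y))) ∂ρ = 1 / 2) :
    ∫ y, Real.sin y ∂ρ = 0 := by
  refine integral_sin_eq_zero_of_forall_exp hM fun n _ => ?_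
  have h1 := integral_mul_gaussianPDFReal_eq_zero hM h √(2 * n)
  have heq : ∀ y : ℝ, y * gaussianPDFReal 0 1 (√(2 * n) * y) =
      (√(2 * Real.pi * (1 : NNReal)))⁻¹ * (y * Real.exp (-y ^ 2) ^ n) := by
    intro y
    unfold gaussianPDFReal
    rw [← Real.exp_nat_mul, sub_zero, mul_pow, Real.sq_sqrt (by positivity)]
    have : -(2 * (n : ℝ) * y ^ 2) / (2 * (1 : NNReal)) = n * -y ^ 2 := by
      simp only [NNReal.coe_one]; ring
    rw [this]
    ring
  simp_rw [heq] at h1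
  rw [integral_const_mul] at h1
  refine (mul_eq_zero.1 h1).resolve_left (inv_ne_zero (Real.sqrt_ne_zero'.2 ?_))
  have := Real.pi_pos
  simp only [NNReal.coe_one]
  positivity

end OddPart

/-! ### Symmetry of laws on the sphere from half-space masses -/

section Symmetry

variable {E : Type*} [NormedAddCommGroup E] [InnerProductSpace ℝ E] [FiniteDimensional ℝ E]
  [MeasurableSpace E] [BorelSpace E]

lemma stdGaussian_map_inner {u : E} (hu : ‖u‖ = 1) :
    (stdGaussian E).map (fun c => inner ℝ c u) = gaussianReal 0 1 := by
  have := IsGaussian.map_eq_gaussianReal (μ := stdGaussian E) (innerSL ℝ u)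
  rw [integral_strongDual_stdGaussian, variance_dual_stdGaussian, innerSL_apply_norm, hu] at this
  simp only [one_pow, Real.toNNReal_one] at this
  rw [← this]
  congr 1
  funext c
  exact real_inner_comm _ _

/-- A law on the unit sphere that gives mass `1 / 2` to every half-space through the origin is
symmetric. -/
theorem map_neg_eq_of_halfspace_sphere {ν : Measure E} [IsProbabilityMeasure ν]
    (hν : ∀ᵐ u ∂ν, ‖u‖ = 1)
    (h : ∀ c : E, c ≠ 0 → ν {u | inner ℝ c u ≤ 0} = 1 / 2) :
    ν.map (fun u => -u) = ν := by
  obtain ⟨u₀, hu₀⟩ := hν.exists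
  have hnull : ∀ b : E, stdGaussian E {b} = 0 := by
    intro b
    have : NullSingletonClass (gaussianReal 0 1) := nullSingletonClass_gaussianReal one_ne_zero
    have hz : gaussianReal 0 1 {inner ℝ b u₀} = 0 := measure_singleton _
    rw [← stdGaussian_map_inner hu₀, Measure.map_apply (by fun_prop) (measurableSet_singleton _)]
      at hz
    exact measure_mono_null (by rintro c rfl; simp) hz
  -- Fubini for the random normal `a + c`: for fixed `c ≠ -a` the half-space has mass `1 / 2`, while
  -- for fixed unit `u` the variable `⟪c, u⟫` is standard normal.
  have havg : ∀ a : E, ∫ u, (gaussianReal 0 1).real (Set.Iic (-inner ℝ a u)) ∂ν = 1 / 2 := by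
    intro a
    set A : Set (E × E) := {q | inner ℝ (a + q.1) q.2 ≤ 0} with hA
    have hAm : MeasurableSet A := by
      have hc : Continuous fun q : E × E => inner ℝ (a + q.1) q.2 := by fun_prop
      exact (isClosed_le hc continuous_const).measurableSet
    have h1 : ((stdGaussian E).prod ν) A = 1 / 2 := by
      rw [Measure.prod_apply hAm]
      have : ∀ᵐ c ∂(stdGaussian E), ν (Prod.mk c ⁻¹' A) = 1 / 2 := by
        have hne : ∀ᵐ c ∂(stdGaussian E), c ≠ -a := by
          rw [ae_iff]
          simpa using hnull (-a)
        filter_upwards [hne] with c hc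
        exact h (a + c) fun h0 => hc (by rw [← add_eq_zero_iff_eq_neg, add_comm]; exact h0)
      rw [lintegral_congr_ae this]
      simp
    rw [Measure.prod_apply_symm hAm] at h1
    have h2 : ∀ᵐ u ∂ν, stdGaussian E ((fun c => (c, u)) ⁻¹' A) =
        gaussianReal 0 1 (Set.Iic (-inner ℝ a u)) := by
      filter_upwards [hν] with u hu
      rw [← stdGaussian_map_inner hu, Measure.map_apply (by fun_prop) measurableSet_Iic]
      congr 1
      ext c
      simp only [hA, Set.mem_preimage, Set.mem_ofPred_eq, inner_add_left, Set.mem_Iic]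
      constructor <;> intro h <;> linarith
    have h3 : ∫ u, (stdGaussian E ((fun c => (c, u)) ⁻¹' A)).toReal ∂ν = 1 / 2 := by
      rw [integral_toReal (measurable_measure_prodMk_right hAm).aemeasurable
        (Filter.Eventually.of_forall fun u => measure_lt_top _ _), h1]
      simp
    rw [← h3]
    refine integral_congr_ae ?_
    filter_upwards [h2] with u hu
    rw [hu, measureReal_def]
  have hsin : ∀ a : E, ∫ u, Real.sin (inner ℝ u a) ∂ν = 0 := by
    intro a
    have hm : Measurable fun u : E => inner ℝ u a := by fun_prop
    have : IsProbabilityMeasure (ν.map fun u : E => inner ℝ u a) :=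
      Measure.isProbabilityMeasure_map hm.aemeasurable
    rw [← integral_map (φ := fun u : E => inner ℝ u a) hm.aemeasurable
      Real.continuous_sin.aestronglyMeasurable]
    refine integral_sin_eq_zero_of_gaussianReal (M := ‖a‖) ?_ fun τ => ?_
    · rw [ae_map_iff hm.aemeasurable (isClosed_le continuous_abs continuous_const).measurableSet]
      filter_upwards [hν] with u hu
      have := abs_real_inner_le_norm u a
      rwa [hu, one_mul] at this
    · have hmeas : Measurable fun y : ℝ => (gaussianReal 0 1).real (Set.Iic (-(τ * y))) :=
        (continuous_iff_continuousAt.2 fun x =>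
          (hasDerivAt_gaussianReal_Iic x).continuousAt).measurable.comp (by fun_prop)
      rw [integral_map hm.aemeasurable hmeas.aestronglyMeasurable, ← havg (τ • a)]
      refine integral_congr_ae (Filter.Eventually.of_forall fun u => ?_)
      beta_reduce
      rw [real_inner_smul_left, real_inner_comm]
  have : IsProbabilityMeasure (ν.map fun u => -u) :=
    Measure.isProbabilityMeasure_map measurable_neg.aemeasurable
  refine Measure.ext_of_charFun (funext fun t => ?_)
  have hm : charFun (ν.map fun u => -u) t = charFun ν (-t) := by
    have := charFun_map_smul (μ := ν) (-1) t
    simpa using this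
  rw [hm, charFun_neg, Complex.conj_eq_iff_im, charFun_apply]
  have hint : Integrable (fun x : E => Complex.exp (inner ℝ x t * Complex.I)) ν := by
    refine Integrable.of_bound (C := 1) ?_ (Filter.Eventually.of_forall fun x => ?_)
    · have : Continuous fun x : E => Complex.exp (inner ℝ x t * Complex.I) := by fun_prop
      exact this.aestronglyMeasurable
    · rw [Complex.norm_exp_ofReal_mul_I]
  have him := integral_im hint
  simp only [RCLike.im_to_complex, Complex.exp_ofReal_mul_I_im] at him
  rw [← him]
  exact hsin t

end Symmetry

/-! ### Wendel's theorem -/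

section Wendel

variable {Ω : Type*} [MeasurableSpace Ω] {P : Measure Ω} [IsProbabilityMeasure P]
  {E : Type*} [NormedAddCommGroup E] [InnerProductSpace ℝ E] [FiniteDimensional ℝ E]
  [MeasurableSpace E] [BorelSpace E]

/-- Independent random vectors that charge no hyperplane through the origin are almost surely
linearly independent, as long as there are at most `dim E` of them. -/
lemma ae_linearIndepOn {ι : Type*} {X : ι → Ω → E} (hX : iIndepFun X P)
    (hm : ∀ j, Measurable (X j))
    (hnull : ∀ j, ∀ c : E, c ≠ 0 → P {ω | inner ℝ c (X j ω) = 0} = 0)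
    (S : Finset ι) (hS : S.card ≤ Module.finrank ℝ E) :
    ∀ᵐ ω ∂P, LinearIndepOn ℝ (fun j => X j ω) (S : Set ι) := by
  classical
  induction S using Finset.induction_on with
  | empty => simp
  | insert j S hj ih =>
    rw [Finset.card_insert_of_notMem hj] at hS
    let Z : Ω → S → E := fun ω i => X i ω
    have hZm : Measurable Z := measurable_pi_lambda _ fun i => hm i
    have hind : IndepFun (X j) Z P := by
      have h := hX.indepFun_finset {j} S (Finset.disjoint_singleton_left.2 hj) hm
      exact h.comp (φ := fun v : ({j} : Finset ι) → E => v ⟨j, Finset.mem_singleton_self j⟩)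
        (ψ := id) (measurable_pi_apply _) measurable_id
    have hprod := (indepFun_iff_map_prod_eq_prod_map_map (hm j).aemeasurable
      hZm.aemeasurable).1 hind
    set A : Set (E × (S → E)) :=
      {q | LinearIndependent ℝ q.2 ∧ q.1 ∈ Submodule.span ℝ (Set.range q.2)} with hA
    -- Linear independence is an open condition, and `A` is a difference of two such conditions.
    have hAm : MeasurableSet A := by
      have hc : Continuous fun q : E × (S → E) => fun o : Option S =>
          Option.casesOn' o q.1 q.2 := by
        refine continuous_pi fun o => ?_
        cases o with
        | none => exact continuous_fst
        | some i => exact (continuous_apply i).comp continuous_snd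
      have h1 : IsOpen {q : E × (S → E) | LinearIndependent ℝ q.2} :=
        (isOpen_setOfPred_linearIndependent (𝕜 := ℝ) (E := E) (ι := S)).preimage continuous_snd
      have h2 : IsOpen {q : E × (S → E) | LinearIndependent ℝ
          (fun o : Option S => Option.casesOn' o q.1 q.2 : Option S → E)} :=
        (isOpen_setOfPred_linearIndependent (𝕜 := ℝ) (E := E) (ι := Option S)).preimage hc
      have hAeq : A = {q : E × (S → E) | LinearIndependent ℝ q.2} \ {q | LinearIndependent ℝ
          (fun o : Option S => Option.casesOn' o q.1 q.2 : Option S → E)} := by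
        ext q
        simp only [hA, Set.mem_ofPred_eq, Set.mem_sdiff, linearIndependent_option']
        tauto
      rw [hAeq]
      exact h1.measurableSet.diff h2.measurableSet
    have hA0 : P.map (fun ω => (X j ω, Z ω)) A = 0 := by
      rw [hprod, Measure.prod_apply_symm hAm]
      refine (lintegral_congr fun v => ?_).trans lintegral_zero
      -- Given the other vectors `v`, their span is proper, hence inside a hyperplane, which `X j`
      -- almost surely avoids.
      have hlt : Module.finrank ℝ (Submodule.span ℝ (Set.range v)) < Module.finrank ℝ E := by
        have := finrank_range_le_card (R := ℝ) v
        rw [Fintype.card_coe] at this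
        exact lt_of_le_of_lt this hS
      have hne : (Submodule.span ℝ (Set.range v))ᗮ ≠ ⊥ := by
        rw [Ne, Submodule.orthogonal_eq_bot_iff]
        intro htop
        rw [htop, finrank_top] at hlt
        exact lt_irrefl _ hlt
      obtain ⟨c, hc, hc0⟩ := Submodule.exists_mem_ne_zero_of_ne_bot hne
      rw [Measure.map_apply (hm j) (measurable_prodMk_right hAm)]
      refine measure_mono_null (fun ω hω => ?_) (hnull j c hc0)
      have hω' : X j ω ∈ Submodule.span ℝ (Set.range v) := hω.2
      exact (Submodule.mem_orthogonal' _ _).1 hc _ hω'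
    rw [Measure.map_apply ((hm j).prodMk hZm) hAm] at hA0
    have hA1 : ∀ᵐ ω ∂P, (X j ω, Z ω) ∉ A := by
      rw [ae_iff]
      simp only [not_not]
      exact hA0
    filter_upwards [ih (by omega), hA1] with ω h1 h2
    rw [Finset.coe_insert]
    refine h1.insert fun hmem => h2 ⟨h1, ?_⟩
    rw [Set.image_eq_range] at hmem
    exact hmem

/-- **Wendel's theorem**: the probability that `n + 1` independent symmetric random vectors, which
charge no hyperplane through the origin, lie in a common open half-space. -/
theorem measureReal_exists_forall_inner_pos {n : ℕ} {X : Fin (n + 1) → Ω → E}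
    (hX : iIndepFun X P) (hm : ∀ j, Measurable (X j))
    (hsymm : ∀ j, (P.map (X j)).map (fun x => -x) = P.map (X j))
    (hnull : ∀ j, ∀ c : E, c ≠ 0 → P {ω | inner ℝ c (X j ω) = 0} = 0) :
    P.real {ω | ∃ c : E, ∀ j, 0 < inner ℝ c (X j ω)} =
      (∑ i ∈ Finset.range (Module.finrank ℝ E), (n.choose i : ℝ)) / 2 ^ n := by
  classical
  have hprob : ∀ j, IsProbabilityMeasure (P.map (X j)) := fun j =>
    Measure.isProbabilityMeasure_map (hm j).aemeasurable
  have hXm : Measurable fun ω j => X j ω := measurable_pi_lambda _ hm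
  have hpi := (iIndepFun_iff_map_fun_eq_pi_map fun j => (hm j).aemeasurable).1 hX
  set O : Set (Fin (n + 1) → E) := {y | ∃ c : E, ∀ j, 0 < inner ℝ c (y j)} with hO
  have hOm : MeasurableSet O := isOpen_exists_forall_inner_pos.measurableSet
  have hflip : ∀ ε : Fin (n + 1) → ℤˣ,
      P.real {ω | (fun j => ε j • X j ω) ∈ O} = P.real {ω | (fun j => X j ω) ∈ O} := by
    intro ε
    have hmp : MeasurePreserving (fun (y : Fin (n + 1) → E) j => ε j • y j)
        (Measure.pi fun j => P.map (X j)) (Measure.pi fun j => P.map (X j)) := by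
      refine measurePreserving_pi (fun j => P.map (X j)) (fun j => P.map (X j))
        (f := fun j x => ε j • x) fun j => ?_
      rcases Int.units_eq_one_or (ε j) with h | h
      · simp only [h, one_smul]
        exact MeasurePreserving.id _
      · have hneg : MeasurePreserving (fun x : E => -x) (P.map (X j)) (P.map (X j)) :=
          ⟨measurable_neg, hsymm j⟩
        simpa [h] using hneg
    have h1 := hmp.measure_preimage hOm.nullMeasurableSet
    rw [← hpi, Measure.map_apply hXm (hmp.measurable hOm), Measure.map_apply hXm hOm] at h1
    exact congrArg ENNReal.toReal h1
  have hflipm : ∀ ε : Fin (n + 1) → ℤˣ, MeasurableSet {ω | (fun j => ε j • X j ω) ∈ O} := by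
    intro ε
    have : Measurable fun ω j => ε j • X j ω := by
      refine measurable_pi_lambda _ fun j => ?_
      rcases Int.units_eq_one_or (ε j) with h | h
      · simpa [h] using hm j
      · simp only [h, Units.neg_smul, one_smul]
        exact (hm j).neg
    exact this hOm
  have hcount : ∀ᵐ ω ∂P, ∑ ε : Fin (n + 1) → ℤˣ,
      Set.indicator {ω | (fun j => ε j • X j ω) ∈ O} (fun _ => (1 : ℝ)) ω =
        2 * ∑ i ∈ Finset.range (Module.finrank ℝ E), (n.choose i : ℝ) := by
    have hLI : ∀ᵐ ω ∂P, ∀ S : Finset (Fin (n + 1)), S.card ≤ Module.finrank ℝ E →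
        LinearIndepOn ℝ (fun j => X j ω) (S : Set (Fin (n + 1))) := by
      rw [ae_all_iff]
      intro S
      by_cases hS : S.card ≤ Module.finrank ℝ E
      · filter_upwards [ae_linearIndepOn hX hm hnull S hS] with ω h _ using h
      · exact Filter.Eventually.of_forall fun ω h => absurd h hS
    filter_upwards [hLI] with ω hω
    have hreg := regionCount_eq (GenPos.of_linearIndepOn hω)
    rw [finrank_top] at hreg
    have hreg' := congrArg (Nat.cast : ℕ → ℝ) hreg
    unfold regionCount at hreg'
    push_cast at hreg'
    rw [← hreg']
    refine Finset.sum_congr rfl fun ε _ => ?_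
    simp [Set.indicator_apply, hO]
  have hint : ∫ ω, ∑ ε : Fin (n + 1) → ℤˣ,
      Set.indicator {ω | (fun j => ε j • X j ω) ∈ O} (fun _ => (1 : ℝ)) ω ∂P =
        2 * ∑ i ∈ Finset.range (Module.finrank ℝ E), (n.choose i : ℝ) := by
    rw [integral_congr_ae hcount]
    simp
  rw [integral_finsetSum _ fun ε _ => (integrable_const (1 : ℝ)).indicator (hflipm ε)] at hint
  simp only [integral_indicator_const _ (hflipm _), hflip, Finset.sum_const, Finset.card_univ,
    Fintype.card_pi, Fintype.card_units_int, Finset.prod_const, Fintype.card_fin, smul_eq_mul,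
    nsmul_eq_mul, mul_one] at hint
  push_cast at hint
  have hgoal : P.real {ω | ∃ c : E, ∀ j, 0 < inner ℝ c (X j ω)} =
      P.real {ω | (fun j => X j ω) ∈ O} := rfl
  rw [hgoal, eq_div_iff (by positivity)]
  rw [pow_succ] at hint
  linarith

/-- Wendel's theorem for random vectors that are only assumed to have all half-spaces through the
origin of probability `1 / 2`. -/
theorem measureReal_exists_forall_inner_pos_of_halfspace [Nontrivial E] {n : ℕ}
    {X : Fin (n + 1) → Ω → E} (hX : iIndepFun X P) (hm : ∀ j, Measurable (X j))
    (h : ∀ j, ∀ c : E, c ≠ 0 → P.real {ω | inner ℝ c (X j ω) ≤ 0} = 1 / 2) :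
    P.real {ω | ∃ c : E, ∀ j, 0 < inner ℝ c (X j ω)} =
      (∑ i ∈ Finset.range (Module.finrank ℝ E), (n.choose i : ℝ)) / 2 ^ n := by
  -- The closed half-spaces of `c` and `-c` have mass `1 / 2` each and cover the space, so their
  -- intersection is null.
  have hnull : ∀ j, ∀ c : E, c ≠ 0 → P {ω | inner ℝ c (X j ω) = 0} = 0 := by
    intro j c hc
    have hmi : Measurable fun ω => inner ℝ c (X j ω) := by
      have := hm j
      fun_prop
    have h1 := h j c hc
    have h2 := h j (-c) (neg_ne_zero.2 hc)
    simp only [inner_neg_left, Left.neg_nonpos_iff] at h2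
    have h3 := measureReal_union_add_inter (μ := P) (s := {ω | inner ℝ c (X j ω) ≤ 0})
      (t := {ω | 0 ≤ inner ℝ c (X j ω)}) (measurableSet_le measurable_const hmi)
    have hu : {ω | inner ℝ c (X j ω) ≤ 0} ∪ {ω | 0 ≤ inner ℝ c (X j ω)} = Set.univ := by
      ext ω; simpa using le_total _ _
    have hi : {ω | inner ℝ c (X j ω) ≤ 0} ∩ {ω | 0 ≤ inner ℝ c (X j ω)} =
        {ω | inner ℝ c (X j ω) = 0} := by
      ext ω; simp [le_antisymm_iff]
    rw [hu, hi, h1, h2, probReal_univ] at h3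
    have h4 : P.real {ω | inner ℝ c (X j ω) = 0} = 0 := by linarith
    rwa [measureReal_eq_zero_iff] at h4
  -- Normalising preserves the sign of every inner product, even at `0`, where `f 0 = 0`.
  set f : E → E := fun x => ‖x‖⁻¹ • x with hf
  have hfm : Measurable f := by fun_prop
  have hpos : ∀ j ω, X j ω ≠ 0 → 0 < ‖X j ω‖⁻¹ := fun j ω h0 => inv_pos.2 (norm_pos_iff.2 h0)
  have hinner : ∀ (c : E) j ω, inner ℝ c (f (X j ω)) = ‖X j ω‖⁻¹ * inner ℝ c (X j ω) :=
    fun c j ω => real_inner_smul_right _ _ _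
  have hle : ∀ (c : E) j ω, inner ℝ c (f (X j ω)) ≤ 0 ↔ inner ℝ c (X j ω) ≤ 0 := by
    intro c j ω
    rw [hinner]
    by_cases h0 : X j ω = 0
    · simp [h0]
    · exact mul_nonpos_iff_pos_imp_nonpos.trans
        ⟨fun h => h.1 (hpos j ω h0), fun h => ⟨fun _ => h, fun _ => (hpos j ω h0).le⟩⟩
  have hlt : ∀ (c : E) j ω, 0 < inner ℝ c (f (X j ω)) ↔ 0 < inner ℝ c (X j ω) := fun c j ω => by
    rw [← not_le, hle, not_le]
  have hzero : ∀ (c : E) j ω, inner ℝ c (f (X j ω)) = 0 → inner ℝ c (X j ω) = 0 := by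
    intro c j ω h0
    refine le_antisymm ((hle c j ω).1 h0.le) ?_
    have := (hle (-c) j ω).1 (by rw [inner_neg_left, h0, neg_zero])
    rwa [inner_neg_left, Left.neg_nonpos_iff] at this
  -- The hyperplane orthogonal to `e` is null and contains `0`, so `X j ≠ 0` almost surely.
  obtain ⟨e, he⟩ := exists_ne (0 : E)
  have key := measureReal_exists_forall_inner_pos (X := fun j ω => f (X j ω))
    (hX.comp (fun _ => f) fun _ => hfm) (fun j => hfm.comp (hm j)) (fun j => ?_)
    (fun j c hc => measure_mono_null (fun ω hω => hzero c j ω hω) (hnull j c hc))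
  · simpa only [hlt] using key
  · have hfX : Measurable fun ω => f (X j ω) := hfm.comp (hm j)
    have : IsProbabilityMeasure (P.map fun ω => f (X j ω)) :=
      Measure.isProbabilityMeasure_map hfX.aemeasurable
    refine map_neg_eq_of_halfspace_sphere ?_ fun c hc => ?_
    · rw [ae_map_iff hfX.aemeasurable (isClosed_eq continuous_norm continuous_const).measurableSet]
      have hne : ∀ᵐ ω ∂P, X j ω ≠ 0 := by
        rw [ae_iff]
        refine measure_mono_null (fun ω hω => ?_) (hnull j e he)
        have : X j ω = 0 := by simpa using hω
        simp [this]
      filter_upwards [hne] with ω hω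
      rw [hf, norm_smul, norm_inv, norm_norm, inv_mul_cancel₀ (norm_ne_zero_iff.2 hω)]
    · have hc' : Continuous fun u : E => inner ℝ c u := by fun_prop
      rw [Measure.map_apply hfX (isClosed_le hc' continuous_const).measurableSet]
      have h1 : (fun ω => f (X j ω)) ⁻¹' {u | inner ℝ c u ≤ 0} = {ω | inner ℝ c (X j ω) ≤ 0} := by
        ext ω
        exact hle c j ω
      rw [h1, ← ENNReal.toReal_eq_toReal_iff' (measure_ne_top _ _) (by simp), ← measureReal_def,
        h j c hc]
      simp

end Wendel

/-- The complement of a lower binomial tail is an upper tail, which the symmetry `i ↦ n - i`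
reflects back. -/
lemma one_sub_sum_range_choose_div (n d : ℕ) (hd : d ≤ n) :
    1 - (∑ i ∈ Finset.range d, (n.choose i : ℝ)) / 2 ^ n =
      1 / 2 ^ n * ∑ i ∈ Finset.Icc 0 (n - d), (n.choose i : ℝ) := by
  have h1 : ∑ i ∈ Finset.range (n + 1), (n.choose i : ℝ) = 2 ^ n := by
    exact_mod_cast Nat.sum_range_choose n
  have h2 : Finset.Icc 0 (n - d) = Finset.range (n - d + 1) := by
    ext i
    simp
  have h3 : ∑ i ∈ Finset.range (n - d + 1), (n.choose i : ℝ) =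
      ∑ k ∈ Finset.range (n - d + 1), (n.choose (d + k) : ℝ) := by
    rw [← Finset.sum_range_reflect]
    refine Finset.sum_congr rfl fun k hk => ?_
    have hk' := Finset.mem_range.1 hk
    rw [← Nat.choose_symm (by omega : d + k ≤ n)]
    congr 2
    omega
  rw [(by omega : n + 1 = d + (n - d + 1)), Finset.sum_range_add] at h1
  rw [h2, h3, eq_sub_of_add_eq' h1]
  field_simp

/-! ### Coverage of the rectangular hull -/

section RectHull

variable {Ω : Type*} [MeasurableSpace Ω] {P : Measure Ω}

lemma medBias_nonneg (Y : Ω → ℝ) (t : ℝ) : 0 ≤ medBias P Y t := le_max_right _ _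

lemma medBias_le_half (Y : Ω → ℝ) (t : ℝ) : medBias P Y t ≤ 1 / 2 :=
  max_le (sub_le_self _ (le_min measureReal_nonneg measureReal_nonneg)) (by norm_num)

/-- All of finitely many independent estimators over- or underestimate `t` with probability at most
`(1 / 2 + Δ) ^ B + (1 / 2 - Δ) ^ B`, if their median biases are at most `Δ ≤ 1 / 2`. -/
lemma measureReal_forall_lt_add_forall_gt_le [IsProbabilityMeasure P] {ι : Type*} [Fintype ι] {Y : ι → Ω → ℝ} {t Δ : ℝ}
    (hY : iIndepFun Y P) (hm : ∀ j, Measurable (Y j)) (hΔ0 : 0 ≤ Δ) (hΔ : Δ ≤ 1 / 2)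
    (h : ∀ j, medBias P (Y j) t ≤ Δ) :
    P.real {ω | ∀ j, t < Y j ω} + P.real {ω | ∀ j, Y j ω < t} ≤
      (1 / 2 + Δ) ^ Fintype.card ι + (1 / 2 - Δ) ^ Fintype.card ι := by
  have hprod : ∀ s : Set ℝ, MeasurableSet s →
      P.real {ω | ∀ j, Y j ω ∈ s} = ∏ j, P.real {ω | Y j ω ∈ s} := by
    intro s hs
    have h1 := hY.measure_inter_preimage_eq_mul Finset.univ (sets := fun _ => s) fun _ _ => hs
    have h2 : {ω | ∀ j, Y j ω ∈ s} = ⋂ j ∈ Finset.univ, Y j ⁻¹' s := by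
      ext ω; simp
    rw [h2, measureReal_def, h1, ENNReal.toReal_prod]
    rfl
  have hgt := hprod (Set.Ioi t) measurableSet_Ioi
  have hlt := hprod (Set.Iio t) measurableSet_Iio
  simp only [Set.mem_Ioi, Set.mem_Iio] at hgt hlt
  have ha : ∀ j, P.real {ω | t < Y j ω} = 1 - P.real {ω | Y j ω - t ≤ 0} := by
    intro j
    have hms : MeasurableSet {ω | Y j ω - t ≤ 0} :=
      measurableSet_le ((hm j).sub_const t) measurable_const
    rw [← probReal_compl_eq_one_sub hms]
    congr 1
    ext ω
    simp
  have hb : ∀ j, P.real {ω | Y j ω < t} = 1 - P.real {ω | 0 ≤ Y j ω - t} := by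
    intro j
    have hms : MeasurableSet {ω | 0 ≤ Y j ω - t} :=
      measurableSet_le measurable_const ((hm j).sub_const t)
    rw [← probReal_compl_eq_one_sub hms]
    congr 1
    ext ω
    simp
  have hbias : ∀ j, 1 / 2 - min (P.real {ω | 0 ≤ Y j ω - t}) (P.real {ω | Y j ω - t ≤ 0}) ≤ Δ :=
    fun j => (le_max_left _ _).trans (h j)
  rw [hgt, hlt, ← Finset.card_univ]
  -- Here `u = 1 / 2 + Δ` and `v = 1 / 2 - Δ`, so `u + v = 1` bounds the sum of the probabilities of
  -- two disjoint events.
  refine prod_add_prod_le_pow_add_pow Finset.univ (by linarith) (by linarith)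
    (fun _ => measureReal_nonneg) (fun _ => measureReal_nonneg) (fun j => ?_) (fun j => ?_)
    fun j => ?_
  · rw [ha]
    linarith [hbias j, min_le_right (P.real {ω | 0 ≤ Y j ω - t}) (P.real {ω | Y j ω - t ≤ 0})]
  · rw [hb]
    linarith [hbias j, min_le_left (P.real {ω | 0 ≤ Y j ω - t}) (P.real {ω | Y j ω - t ≤ 0})]
  · have hmono : P.real {ω | Y j ω < t} ≤ P.real {ω | Y j ω - t ≤ 0} :=
      by
      refine measureReal_mono fun ω (hω : Y j ω < t) => ?_
      exact (sub_nonpos.2 hω.le : Y j ω - t ≤ 0)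
    rw [ha]
    linarith

lemma measureReal_notMem_rectHull_le [IsProbabilityMeasure P] {d B : ℕ} (hd : 1 ≤ d) (hB : 1 ≤ B)
    (θ₀ : EuclideanSpace ℝ (Fin d)) (θ : Fin B → Ω → EuclideanSpace ℝ (Fin d))
    (hmeas : ∀ j, Measurable (θ j)) (hindep : iIndepFun θ P) :
    P.real {ω | θ₀ ∉ rectHull (fun j : Fin B => θ j ω)} ≤
      (d : ℝ) * ((1 / 2 + maxMedBias P θ θ₀) ^ B + (1 / 2 - maxMedBias P θ θ₀) ^ B) := by
  have : Nonempty (Fin d) := ⟨⟨0, hd⟩⟩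
  have : Nonempty (Fin B) := ⟨⟨0, hB⟩⟩
  set Δ := maxMedBias P θ θ₀
  have hle : ∀ k j, medBias P (fun ω => θ j ω k) (θ₀ k) ≤ Δ := fun k j =>
    (le_ciSup (f := fun j => medBias P (fun ω => θ j ω k) (θ₀ k)) (Set.finite_range _).bddAbove
      j).trans (le_ciSup (f := fun k => ⨆ j, medBias P (fun ω => θ j ω k) (θ₀ k))
        (Set.finite_range _).bddAbove k)
  have hΔ0 : 0 ≤ Δ := (medBias_nonneg _ _).trans (hle ⟨0, hd⟩ ⟨0, hB⟩)
  have hΔ : Δ ≤ 1 / 2 := ciSup_le fun k => ciSup_le fun j => medBias_le_half _ _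
  have hsub : {ω | θ₀ ∉ rectHull (fun j : Fin B => θ j ω)} ⊆
      ⋃ k : Fin d, ({ω | ∀ j, θ₀ k < θ j ω k} ∪ {ω | ∀ j, θ j ω k < θ₀ k}) := by
    intro ω hω
    simp only [rectHull, Set.mem_ofPred_eq, not_forall, Set.mem_Icc, not_and_or, not_le] at hω
    obtain ⟨k, hk⟩ := hω
    refine Set.mem_iUnion.2 ⟨k, hk.imp (fun h j => ?_) fun h j => ?_⟩
    · exact h.trans_le (ciInf_le (Set.finite_range _).bddBelow j)
    · exact (le_ciSup (Set.finite_range fun j => θ j ω k).bddAbove j).trans_lt h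
  have hcoord : ∀ k : Fin d, Measurable fun x : EuclideanSpace ℝ (Fin d) => x k := fun k => by
    fun_prop
  calc P.real {ω | θ₀ ∉ rectHull (fun j : Fin B => θ j ω)}
      ≤ P.real (⋃ k : Fin d, ({ω | ∀ j, θ₀ k < θ j ω k} ∪ {ω | ∀ j, θ j ω k < θ₀ k})) :=
        measureReal_mono hsub
    _ ≤ ∑ k : Fin d, P.real ({ω | ∀ j, θ₀ k < θ j ω k} ∪ {ω | ∀ j, θ j ω k < θ₀ k}) :=
        measureReal_iUnion_fintype_le _
    _ ≤ ∑ _k : Fin d, ((1 / 2 + Δ) ^ B + (1 / 2 - Δ) ^ B) := by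
        refine Finset.sum_le_sum fun k _ => (measureReal_union_le _ _).trans ?_
        have := measureReal_forall_lt_add_forall_gt_le (P := P) (t := θ₀ k)
          (hindep.comp (fun _ x => x k) fun _ => hcoord k)
          (fun j => (hcoord k).comp (hmeas j)) hΔ0 hΔ (hle k)
        rwa [Fintype.card_fin] at this
    _ = d * ((1 / 2 + Δ) ^ B + (1 / 2 - Δ) ^ B) := by
        rw [Finset.sum_const, Finset.card_univ, Fintype.card_fin, nsmul_eq_mul]

end RectHull

theorem lemma2 {Ω : Type*} [MeasurableSpace Ω] (P : Measure Ω) [IsProbabilityMeasure P]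
    (d B : ℕ) (hd : 1 ≤ d) (θ₀ : EuclideanSpace ℝ (Fin d))
    (θ : Fin B → Ω → EuclideanSpace ℝ (Fin d))
    (hmeas : ∀ j, Measurable (θ j)) (hindep : iIndepFun θ P) :
    ((∀ j : Fin B, ∀ c : EuclideanSpace ℝ (Fin d), c ≠ 0 →
        P.real {ω | inner ℝ c (θ j ω - θ₀) ≤ 0} = 1 / 2) →
      d + 1 ≤ B →
      P.real {ω | θ₀ ∈ convexHull ℝ (Set.range fun j : Fin B => θ j ω)} =
        1 / 2 ^ (B - 1) * ∑ i ∈ Finset.Icc 0 (B - d - 1), ((B - 1).choose i : ℝ)) ∧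
    (1 ≤ B →
      P.real {ω | θ₀ ∉ rectHull (fun j : Fin B => θ j ω)} ≤
        (d : ℝ) * ((1 / 2 + maxMedBias P θ θ₀) ^ B + (1 / 2 - maxMedBias P θ θ₀) ^ B)) := by
  refine ⟨fun h hB => ?_, fun hB => measureReal_notMem_rectHull_le hd hB θ₀ θ hmeas hindep⟩
  -- Wendel's theorem is stated for `n + 1` vectors, so `n = B - 1`.
  obtain ⟨n, rfl⟩ := Nat.exists_eq_add_of_le' (by omega : 1 ≤ B)
  have : Nonempty (Fin d) := ⟨⟨0, hd⟩⟩
  have hXm : ∀ j, Measurable fun ω => θ j ω - θ₀ := fun j => (hmeas j).sub_const θ₀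
  have key := measureReal_exists_forall_inner_pos_of_halfspace (X := fun j ω => θ j ω - θ₀)
    (hindep.comp (fun _ x => x - θ₀) fun _ => measurable_id.sub_const θ₀) hXm h
  have hset : {ω | θ₀ ∈ convexHull ℝ (Set.range fun j => θ j ω)} =
      {ω | ∃ c : EuclideanSpace ℝ (Fin d), ∀ j, 0 < inner ℝ c (θ j ω - θ₀)}ᶜ := by
    ext ω
    rw [Set.mem_compl_iff, Set.mem_ofPred_eq, Set.mem_ofPred_eq,
      ← notMem_convexHull_range_iff (fun j => θ j ω) θ₀, not_not]
  have hms : MeasurableSet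
      {ω | ∃ c : EuclideanSpace ℝ (Fin d), ∀ j, 0 < inner ℝ c (θ j ω - θ₀)} :=
    (measurable_pi_lambda _ hXm) isOpen_exists_forall_inner_pos.measurableSet
  rw [hset, probReal_compl_eq_one_sub hms, key, finrank_euclideanSpace_fin, Nat.add_sub_cancel,
    one_sub_sum_range_choose_div n d (by omega), (by omega : n + 1 - d - 1 = n - d)]
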